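/- Let $m,s$ be integers with $1<m\le s$, and let $\mathbb H$ be the hyperbolic upper half-plane, on which $PSL(2,\mathbb R)$ acts by Möbius transformations. For integers $k,n\ge 1$ put $c_n=2^n\cdot 10$, $p_{k,n}=13+(5k-3)\cdot 2^n\cdot 10$, $q_{k,n}=17+(5k-3)\cdot 2^n\cdot 10$, and let $\Gamma_{m,s}\le PSL(2,\mathbb R)$ be the subgroup generated by the Möbius transformations $$f_t(z)=\frac{-5tz+(25t^2-1)}{z-5t},\quad g_{k,n}(z)=\frac{-q_{k,n}z+\frac{q_{k,n}p_{k,n}-1}{c_n}}{c_nz-p_{k,n}},\quad h_{k,n}(z)=\frac{-p_{k,n}z+\frac{q_{k,n}p_{k,n}-1}{c_n}}{c_nz-q_{k,n}}$$ and their inverses, where $t\in\{1,\dots,s-1\}$, $k\in\{1,\dots,m\}$ and $n\ge 1$. Let $S_{m,s}=\mathbb H/\Gamma_{m,s}$ be the orbit space. Then $\Gamma_{m,s}$ is a geometric Schottky group, it is Fuchsian (a discrete subgroup of $PSL(2,\mathbb R)$), it acts freely and properly discontinuously on $\mathbb H$, and for every base point $x\in S_{m,s}$ the fundamental group $\pi_1(S_{m,s},x)$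 is isomorphic to $\Gamma_{m,s}$. Here a subgroup of $PSL(2,\mathbb R)$ is a *geometric Schottky group* if it is generated by a family $\{f_k\}_{k\in I}$ which is part of a Schottky description $(\{A_k\},\{f_k\})_{k\in I}$: $I\subseteq\mathbb Z\setminus\{0\}$ satisfies $I=-I$; the $A_k\subset\mathbb R$ are bounded nonempty open intervals with mutually disjoint closures; no $\overline{A_k}$, viewed in the boundary circle of the disc model via $z\mapsto\frac{z-i}{z+i}$, contains a closed half-circle; for each $k\in I$, the half-circle $C_k\subset\mathbb H$ with the same end points as $A_k$ is the isometric circle $\{z\in\mathbb H:|cz+d|^{-2}=1\}$ of $f_k(z)=\frac{az+b}{cz+d}$ ($ad-bc=1$, $c\ne 0$), and $f_{-k}=f_k^{-1}$; each $f_k$ is hyperbolic; and for some $\varepsilon>0$ the closed hyperbolic $\varepsilon$-neighbourhoods of the half-circles $C_k$, $k\in I$, are pairwise disjoint. -/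

import Mathlib

open scoped MatrixGroups UpperHalfPlane ComplexConjugate

noncomputable section

namespace SchottkySurface

/-! ### The action of `PSL(2, ℝ)` on the hyperbolic plane -/

/-- `PSL(2, ℝ)` acts on the upper half-plane by Möbius transformations, through its canonical
inclusion into `PGL(2, ℝ)`. -/
instance pslAction : MulAction PSL(2, ℝ) ℍ :=
  MulAction.compHom ℍ (Matrix.ProjectiveSpecialLinearGroup.toPGL (n := Fin 2) (R := ℝ))

theorem psl_smul_mk (A : SL(2, ℝ)) (z : ℍ) : (A : PSL(2, ℝ)) • z = A • z := rfl

/-- The class of a real matrix of determinant one acts by `z ↦ (az + b) / (cz + d)`. -/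
theorem coe_psl_smul (A : SL(2, ℝ)) (z : ℍ) :
    (((A : PSL(2, ℝ)) • z : ℍ) : ℂ) =
      ((A 0 0 : ℂ) * z + (A 0 1 : ℂ)) / ((A 1 0 : ℂ) * z + (A 1 1 : ℂ)) := by
  rw [psl_smul_mk, UpperHalfPlane.coe_specialLinearGroup_apply]
  rfl

/-- An element of `PSL(2, ℝ)` is hyperbolic if its matrices `± A` have two distinct real
eigenvalues. -/
def IsHyperbolic (g : PSL(2, ℝ)) : Prop :=
  ∃ A : SL(2, ℝ), (A : PSL(2, ℝ)) = g ∧ (A : Matrix (Fin 2) (Fin 2) ℝ).IsHyperbolic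

/-- The isometric circle `{z ∈ ℍ : |cz + d|⁻² = 1}` of `z ↦ (az + b) / (cz + d)`, for `c ≠ 0`
(and the empty set for `c = 0`). -/
def isometricCircle (g : PSL(2, ℝ)) : Set ℍ :=
  {z | ∃ A : SL(2, ℝ), (A : PSL(2, ℝ)) = g ∧ A 1 0 ≠ 0 ∧
    (‖(A 1 0 : ℂ) * (z : ℂ) + (A 1 1 : ℂ)‖ ^ 2)⁻¹ = 1}

/-- The half-circle of `ℍ`, orthogonal to the real axis, with end points `a < b`. -/
def halfCircle (a b : ℝ) : Set ℍ :=
  {z | ‖(z : ℂ) - (((a + b) / 2 : ℝ) : ℂ)‖ = (b - a) / 2}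

/-! ### Geometric Schottky groups -/

/-- The Cayley transform, from the upper half-plane model to the disc model; it sends the real line
into the unit circle. -/
def cayley (z : ℂ) : ℂ := (z - Complex.I) / (z + Complex.I)

/-- The closed half of the unit circle with midpoint `u`. -/
def closedHalfUnitCircle (u : ℂ) : Set ℂ := {w | ‖w‖ = 1 ∧ 0 ≤ (w * conj u).re}

/-- A Schottky description `({A_k}, {f_k})_{k ∈ I}`, where `A_k` is the open interval
`(a k, b k)`. Values of `a`, `b`, `f` outside `I` play no role. -/
structure IsSchottkyDescription (I : Set ℤ) (a b : ℤ → ℝ) (f : ℤ → PSL(2, ℝ)) : Prop where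
  zero_notMem : (0 : ℤ) ∉ I
  neg_mem : ∀ k ∈ I, -k ∈ I
  lt : ∀ k ∈ I, a k < b k
  /-- The closures of the intervals `A_k` are mutually disjoint. -/
  disjoint_closure : ∀ k ∈ I, ∀ l ∈ I, k ≠ l →
    Disjoint (closure (Set.Ioo (a k) (b k))) (closure (Set.Ioo (a l) (b l)))
  /-- Seen in the boundary circle of the disc model, no closed interval contains a closed
  half-circle. -/
  not_halfCircle_subset : ∀ k ∈ I, ∀ u : ℂ, ‖u‖ = 1 →
    ¬ closedHalfUnitCircle u ⊆ (fun x : ℝ => cayley (x : ℂ)) '' closure (Set.Ioo (a k) (b k))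
  /-- The half-circle over `A_k` is the isometric circle of `f_k`, and `f_{-k} = f_k⁻¹` (so the one
  over `A_{-k}` is the isometric circle of `f_k⁻¹`). -/
  isometricCircle_eq : ∀ k ∈ I, isometricCircle (f k) = halfCircle (a k) (b k)
  map_neg : ∀ k ∈ I, f (-k) = (f k)⁻¹
  hyperbolic : ∀ k ∈ I, IsHyperbolic (f k)
  /-- For some `ε > 0`, the closed hyperbolic `ε`-neighbourhoods of the half-circles are pairwise
  disjoint. -/
  disjoint_nhds : ∃ ε : ℝ, 0 < ε ∧ ∀ k ∈ I, ∀ l ∈ I, k ≠ l →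
    Disjoint (Metric.cthickening ε (halfCircle (a k) (b k)))
      (Metric.cthickening ε (halfCircle (a l) (b l)))

/-- A geometric Schottky group: a subgroup of `PSL(2, ℝ)` generated by the transformations of a
Schottky description. -/
def IsGeometricSchottky (Γ : Subgroup PSL(2, ℝ)) : Prop :=
  ∃ (I : Set ℤ) (a b : ℤ → ℝ) (f : ℤ → PSL(2, ℝ)),
    IsSchottkyDescription I a b f ∧ Γ = Subgroup.closure (f '' I)

/-- A Fuchsian group: a discrete subgroup of `PSL(2, ℝ)`. -/
def IsFuchsian (Γ : Subgroup PSL(2, ℝ)) : Prop := DiscreteTopology Γ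

/-! ### The generators -/

/-- `f_t(z) = (-5t z + (25t² - 1)) / (z - 5t)`. -/
def fMat (t : ℕ) : SL(2, ℝ) :=
  ⟨!![-5 * (t : ℝ), 25 * (t : ℝ) ^ 2 - 1; 1, -5 * (t : ℝ)], by
    rw [Matrix.det_fin_two_of]; ring⟩

/-- The number `2ⁿ · 10`. -/
def cCoef (n : ℕ) : ℝ := 2 ^ n * 10

/-- The number `13 + (5k - 3) · 2ⁿ · 10`. -/
def pCoef (k n : ℕ) : ℝ := 13 + (5 * (k : ℝ) - 3) * 2 ^ n * 10

/-- The number `17 + (5k - 3) · 2ⁿ · 10`. -/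
def qCoef (k n : ℕ) : ℝ := 17 + (5 * (k : ℝ) - 3) * 2 ^ n * 10

theorem cCoef_ne_zero (n : ℕ) : cCoef n ≠ 0 := by unfold cCoef; positivity

/-- `g_{k,n}(z) = (-q z + (q p - 1) / c) / (c z - p)`, where `c = 2ⁿ · 10`,
`p = 13 + (5k - 3) · 2ⁿ · 10` and `q = 17 + (5k - 3) · 2ⁿ · 10`. -/
def gMat (k n : ℕ) : SL(2, ℝ) :=
  ⟨!![-qCoef k n, (qCoef k n * pCoef k n - 1) / cCoef n; cCoef n, -pCoef k n], by
    rw [Matrix.det_fin_two_of]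
    field_simp [cCoef_ne_zero n]
    ring⟩

/-- `h_{k,n}(z) = (-p z + (q p - 1) / c) / (c z - q)`, with the same `c`, `p`, `q`. -/
def hMat (k n : ℕ) : SL(2, ℝ) :=
  ⟨!![-pCoef k n, (qCoef k n * pCoef k n - 1) / cCoef n; cCoef n, -qCoef k n], by
    rw [Matrix.det_fin_two_of]
    field_simp [cCoef_ne_zero n]
    ring⟩

/-- The transformations `f_t` (`1 ≤ t ≤ s - 1`), `g_{k,n}` and `h_{k,n}` (`1 ≤ k ≤ m`, `1 ≤ n`). -/
def generators (m s : ℕ) : Set PSL(2, ℝ) :=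
  {φ | (∃ t : ℕ, 1 ≤ t ∧ t + 1 ≤ s ∧ φ = (fMat t : PSL(2, ℝ))) ∨
    (∃ k n : ℕ, 1 ≤ k ∧ k ≤ m ∧ 1 ≤ n ∧ φ = (gMat k n : PSL(2, ℝ))) ∨
    (∃ k n : ℕ, 1 ≤ k ∧ k ≤ m ∧ 1 ≤ n ∧ φ = (hMat k n : PSL(2, ℝ)))}

/-- The group `Γ_{m,s}` generated by the above transformations and their inverses. -/
def Gam (m s : ℕ) : Subgroup PSL(2, ℝ) :=
  Subgroup.closure {φ | φ ∈ generators m s ∨ φ⁻¹ ∈ generators m s}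

/-- The surface `S_{m,s} = ℍ / Γ_{m,s}`, the orbit space with the quotient topology. -/
abbrev Surf (m s : ℕ) : Type := MulAction.orbitRel.Quotient (Gam m s) ℍ

end SchottkySurface

end

/-!
The isometric circles of the generators and of their inverses are Euclidean half-circles with centres
`x i` and radii `r i`, and any two of them are separated on the real line by a gap of at least the
larger radius (`isSeparatedPairing_letterMat`). This scale invariant separation bounds the
hyperbolic distance between two of the circles from below by `arcosh (3 / 2)`
(`arcosh_le_dist_of_mem_halfCircle`), and this gives the Schottky description although the circles
accumulate at the points `5k - 3`.

The other claims follow from one estimate: there is a `δ > 0` such that every nontrivial element of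
the group moves every point by at least `δ`. An isometric action on a proper space with this property
is free and properly discontinuous, and the group is discrete because an element that moves `i` by
less than `δ` is trivial. Hence the simply connected plane covers the orbit space with the group as
deck group, and the group is isomorphic to the fundamental group.

By `le_cosh_dist_smul`, it suffices for the estimate that nontrivial elements have traces bounded
away from `±2`; `IsSeparatedPairing.eq_one_or_three_le` shows `|tr| ≥ 3`. The trace is invariant under
conjugation, so only cyclically reduced words matter. Ping-pong on the orbit of `∞` shows that a
reduced word `A = (a, b; c, d)` sends `∞` into the half-sized disc in the isometric circle of the
inverse of its first letter, that `A⁻¹` sends `∞` into the half-sized disc in that of its last letter,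
and that `|c|` is at least twice the inverse radius of the latter if the word has two letters or more.
As `tr A = c (A ∞ - A⁻¹ ∞)` and the two discs are far apart, the trace is large.
-/

namespace SchottkySurface

/-! ### Words in a separated family of side pairings -/

/-- A family `M` of matrices in `SL(2, ℝ)`, closed under inversion through the involution `σ`, such
that `M i` has the isometric circle with centre `x i` and radius `r i`, i.e. its bottom row is
`(c, -c x i)` with `|c| r i = 1`. Distinct circles are separated: the gap between the intervals they
span on the real line is at least the larger of the two radii. -/
structure IsSeparatedPairing {ι : Type*} (M : ι → SL(2, ℝ)) (σ : ι → ι) (x r : ι → ℝ) : Prop where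
  involutive : Function.Involutive σ
  ne_self : ∀ i, σ i ≠ i
  map_inv : ∀ i, M (σ i) = (M i)⁻¹
  radius_pos : ∀ i, 0 < r i
  radius_inv : ∀ i, r (σ i) = r i
  abs_mul_radius : ∀ i, |M i 1 0| * r i = 1
  bottom_row : ∀ i, M i 1 1 = -(M i 1 0 * x i)
  separated : ∀ i j, i ≠ j → r i + r j + max (r i) (r j) ≤ |x i - x j|

/-- The matrix spelled by a word. -/
def wordProd {ι : Type*} (M : ι → SL(2, ℝ)) (l : List ι) : SL(2, ℝ) := (l.map M).prod

/-- A word is reduced if no letter is followed by its inverse. -/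
def IsReducedWord {ι : Type*} (σ : ι → ι) (l : List ι) : Prop := l.IsChain fun i j => σ i ≠ j

theorem det_eq_one (A : SL(2, ℝ)) : A 0 0 * A 1 1 - A 0 1 * A 1 0 = 1 := by
  have := A.2
  rwa [Matrix.det_fin_two] at this

theorem mul_entry (A B : SL(2, ℝ)) (i j : Fin 2) :
    (A * B) i j = A i 0 * B 0 j + A i 1 * B 1 j := by
  rw [Matrix.SpecialLinearGroup.coe_mul, Matrix.mul_apply, Fin.sum_univ_two]

theorem inv_zero_zero (A : SL(2, ℝ)) : A⁻¹ 0 0 = A 1 1 := by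
  rw [Matrix.SpecialLinearGroup.SL2_inv_expl]; rfl

theorem inv_one_zero (A : SL(2, ℝ)) : A⁻¹ 1 0 = -A 1 0 := by
  rw [Matrix.SpecialLinearGroup.SL2_inv_expl]; rfl

theorem inv_one_one (A : SL(2, ℝ)) : A⁻¹ 1 1 = A 0 0 := by
  rw [Matrix.SpecialLinearGroup.SL2_inv_expl]; rfl

/-- The trace is `c` times the distance between the images of `∞` under the matrix and its
inverse. -/
theorem trace_eq_mul_sub (A : SL(2, ℝ)) (hA : A 1 0 ≠ 0) :
    A 0 0 + A 1 1 = A 1 0 * (A 0 0 / A 1 0 - -(A 1 1) / A 1 0) := by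
  field_simp
  ring

theorem trace_conj (A B : SL(2, ℝ)) :
    (A * B * A⁻¹) 0 0 + (A * B * A⁻¹) 1 1 = B 0 0 + B 1 1 := by
  have := Matrix.trace_mul_cycle (A : Matrix (Fin 2) (Fin 2) ℝ) B
    ((A⁻¹ : SL(2, ℝ)) : Matrix (Fin 2) (Fin 2) ℝ)
  rw [← Matrix.SpecialLinearGroup.coe_mul, ← Matrix.SpecialLinearGroup.coe_mul,
    ← Matrix.SpecialLinearGroup.coe_mul, ← Matrix.SpecialLinearGroup.coe_mul,
    inv_mul_cancel, one_mul, Matrix.trace_fin_two, Matrix.trace_fin_two] at this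
  exact this

@[simp] theorem wordProd_nil {ι : Type*} (M : ι → SL(2, ℝ)) : wordProd M [] = 1 := rfl

@[simp] theorem wordProd_cons {ι : Type*} (M : ι → SL(2, ℝ)) (i : ι) (l : List ι) :
    wordProd M (i :: l) = M i * wordProd M l := by
  simp [wordProd]

@[simp] theorem wordProd_append {ι : Type*} (M : ι → SL(2, ℝ)) (l l' : List ι) :
    wordProd M (l ++ l') = wordProd M l * wordProd M l' := by
  simp [wordProd]

/-- A word that is not reduced contains a letter followed by its inverse. -/
theorem exists_cancelling {ι : Type*} {σ : ι → ι} {l : List ι} (hl : ¬ IsReducedWord σ l) :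
    ∃ l₁ i l₂, l = l₁ ++ i :: σ i :: l₂ := by
  induction l with
  | nil => exact absurd List.IsChain.nil hl
  | cons i l ih =>
    cases l with
    | nil => exact absurd (List.IsChain.singleton i) hl
    | cons j l =>
      by_cases hij : σ i = j
      · exact ⟨[], i, l, by rw [hij]; rfl⟩
      · obtain ⟨l₁, k, l₂, e⟩ := ih fun h' => hl (List.IsChain.cons_cons hij h')
        exact ⟨i :: l₁, k, l₂, by rw [e]; rfl⟩

namespace IsSeparatedPairing

variable {ι : Type*} {M : ι → SL(2, ℝ)} {σ : ι → ι} {x r : ι → ℝ}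

theorem entry_ne_zero (h : IsSeparatedPairing M σ x r) (i : ι) : M i 1 0 ≠ 0 := by
  intro h0
  have := h.abs_mul_radius i
  simp [h0] at this

theorem inv_radius (h : IsSeparatedPairing M σ x r) (i : ι) : (r i)⁻¹ = |M i 1 0| :=
  (eq_inv_of_mul_eq_one_left (h.abs_mul_radius i)).symm

/-- The image of `∞` under `M i` is the centre of the isometric circle of the inverse of `M i`. -/
theorem top_left (h : IsSeparatedPairing M σ x r) (i : ι) : M i 0 0 = M i 1 0 * x (σ i) := by
  have := h.bottom_row (σ i)
  rw [h.map_inv, inv_one_one, inv_one_zero] at this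
  linarith

/-- One step of the ping-pong, for `B` a matrix sending `∞` to `y = B 0 0 / B 1 0`: the lower left
entry of `M i * B` is the product of those of the factors and of the distance from `y` to the centre
of the isometric circle of `M i`; and `M i` sends `y` to a point whose distance from the centre of
the inverse circle is inversely proportional to that distance. -/
theorem step (h : IsSeparatedPairing M σ x r) (i : ι) (B : SL(2, ℝ)) (hB : B 1 0 ≠ 0)
    (hy : 2 * r i ≤ |B 0 0 / B 1 0 - x i|) :
    |(M i * B) 1 0| = (r i)⁻¹ * |B 1 0| * |B 0 0 / B 1 0 - x i| ∧
    |(M i * B) 0 0 / (M i * B) 1 0 - x (σ i)| ≤ r i / 2 := by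
  have hc := h.entry_ne_zero i
  have hr := h.radius_pos i
  set y := B 0 0 / B 1 0 with hy_def
  have hBy : B 0 0 = B 1 0 * y := by rw [hy_def]; field_simp
  have hpos : 0 < |y - x i| := by linarith
  have hyx : y - x i ≠ 0 := abs_pos.mp hpos
  have e1 : (M i * B) 1 0 = M i 1 0 * B 1 0 * (y - x i) := by
    rw [mul_entry, h.bottom_row, hBy]; ring
  refine ⟨by rw [e1, abs_mul, abs_mul, h.inv_radius], ?_⟩
  have hdet := det_eq_one (M i)
  have e2 : (M i * B) 0 0 / (M i * B) 1 0 - x (σ i) = -((M i 1 0 ^ 2 * (y - x i))⁻¹) := by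
    rw [e1, mul_entry, hBy]
    rw [h.bottom_row, h.top_left] at hdet
    rw [h.top_left]
    field_simp
    linear_combination -hdet
  rw [e2, abs_neg, abs_inv, abs_mul, abs_pow, mul_inv, ← inv_pow, ← h.inv_radius, inv_inv]
  rw [← div_eq_mul_inv, div_le_iff₀ hpos]
  nlinarith

/-- A point near the centre of the circle of `j` is far from the centre of any other circle. -/
theorem far (h : IsSeparatedPairing M σ x r) {i j : ι} (hij : i ≠ j) {y : ℝ}
    (hy : |y - x j| ≤ r j / 2) : 2 * r i ≤ |y - x i| ∧ r j ≤ |y - x i| := by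
  have h1 := h.separated i j hij
  have h2 : |x i - x j| ≤ |y - x j| + |y - x i| := by
    rw [abs_sub_comm y (x i), add_comm]; exact abs_sub_le _ _ _
  have := h.radius_pos i
  have := h.radius_pos j
  have := le_max_left (r i) (r j)
  have := le_max_right (r i) (r j)
  constructor <;> linarith

/-- A reduced word starting with the letter `i` sends `∞` into the disc of half the radius inside
the isometric circle of the inverse of `M i`, and its own isometric circle is at most as large as
that of `M i`. -/
theorem head_bound (h : IsSeparatedPairing M σ x r) (i : ι) (l : List ι)
    (hl : IsReducedWord σ (i :: l)) :
    (r i)⁻¹ ≤ |wordProd M (i :: l) 1 0| ∧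
    |wordProd M (i :: l) 0 0 / wordProd M (i :: l) 1 0 - x (σ i)| ≤ r i / 2 := by
  induction l generalizing i with
  | nil =>
    have hr := h.radius_pos i
    have hc := h.entry_ne_zero i
    simp only [wordProd_cons, wordProd_nil, mul_one, h.inv_radius, le_refl, true_and]
    rw [h.top_left, mul_div_cancel_left₀ _ hc, sub_self, abs_zero]
    positivity
  | cons j l ih =>
    rw [IsReducedWord, List.isChain_cons_cons] at hl
    obtain ⟨hB, hy⟩ := ih j hl.2
    rw [wordProd_cons M i]
    set B := wordProd M (j :: l)
    have hri := h.radius_pos i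
    have hrj := h.radius_pos j
    have hB0 : 0 < |B 1 0| := lt_of_lt_of_le (by positivity) hB
    have hij : i ≠ σ j := fun e => hl.1 (by rw [e, h.involutive])
    rw [← h.radius_inv j] at hy
    obtain ⟨f1, f2⟩ := h.far hij hy
    rw [h.radius_inv] at f2
    obtain ⟨s1, s2⟩ := h.step i B (abs_pos.mp hB0) f1
    refine ⟨?_, s2⟩
    rw [s1, mul_assoc]
    refine le_mul_of_one_le_right (by positivity) ?_
    calc (1 : ℝ) = (r j)⁻¹ * r j := (inv_mul_cancel₀ hrj.ne').symm
      _ ≤ _ := by gcongr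

/-- Prepending a letter to a nonempty word, so that it stays reduced, at least doubles the lower left
entry. -/
theorem two_mul_abs_entry_le (h : IsSeparatedPairing M σ x r) (i j : ι) (l : List ι)
    (hl : IsReducedWord σ (i :: j :: l)) :
    2 * |wordProd M (j :: l) 1 0| ≤ |wordProd M (i :: j :: l) 1 0| := by
  rw [IsReducedWord, List.isChain_cons_cons] at hl
  obtain ⟨hB, hy⟩ := h.head_bound j l hl.2
  rw [wordProd_cons M i]
  set B := wordProd M (j :: l)
  have hri := h.radius_pos i
  have hrj := h.radius_pos j
  have hB0 : 0 < |B 1 0| := lt_of_lt_of_le (by positivity) hB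
  have hij : i ≠ σ j := fun e => hl.1 (by rw [e, h.involutive])
  rw [← h.radius_inv j] at hy
  have f1 := (h.far hij hy).1
  rw [(h.step i B (abs_pos.mp hB0) f1).1]
  calc 2 * |B 1 0| = (r i)⁻¹ * |B 1 0| * (2 * r i) := by field_simp
    _ ≤ _ := by gcongr

/-- The inverse of a word is spelled by the reversed word in the inverse letters. -/
theorem wordProd_inv (h : IsSeparatedPairing M σ x r) (l : List ι) :
    (wordProd M l)⁻¹ = wordProd M (l.map σ).reverse := by
  induction l with
  | nil => simp
  | cons i l ih => simp [mul_inv_rev, ih, h.map_inv]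

theorem isReducedWord_inv (h : IsSeparatedPairing M σ x r) {l : List ι}
    (hl : IsReducedWord σ l) : IsReducedWord σ (l.map σ).reverse := by
  rw [IsReducedWord, List.isChain_reverse, List.isChain_map]
  refine List.IsChain.imp (fun a b hab e => hab ?_) hl
  rw [← e, h.involutive]

/-- The bounds of `head_bound` for the inverse of a reduced word, in terms of its last letter. -/
theorem last_bound (h : IsSeparatedPairing M σ x r) (l : List ι) (n : ι)
    (hl : IsReducedWord σ (l ++ [n])) :
    (r n)⁻¹ ≤ |wordProd M (l ++ [n]) 1 0| ∧
    |-(wordProd M (l ++ [n]) 1 1) / wordProd M (l ++ [n]) 1 0 - x n| ≤ r n / 2 := by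
  have hl' := h.isReducedWord_inv hl
  have hinv := h.wordProd_inv (l ++ [n])
  rw [List.map_append, List.reverse_append, List.map_singleton, List.reverse_singleton,
    List.singleton_append] at hl' hinv
  have := h.head_bound _ _ hl'
  rw [← hinv, inv_zero_zero, inv_one_zero, abs_neg, h.involutive, h.radius_inv, div_neg,
    ← neg_div] at this
  exact this

/-- A reduced word of length at least two whose first letter is not the inverse of the last one has
a trace of absolute value at least `3`. -/
theorem three_le_abs_trace (h : IsSeparatedPairing M σ x r) (i n : ι) (l : List ι)
    (hl : IsReducedWord σ (i :: (l ++ [n]))) (hin : σ i ≠ n) :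
    3 ≤ |wordProd M (i :: (l ++ [n])) 0 0 + wordProd M (i :: (l ++ [n])) 1 1| := by
  obtain ⟨hB, hy⟩ := h.head_bound i _ hl
  obtain ⟨-, hy'⟩ := h.last_bound (i :: l) n hl
  have hc : 2 * (r n)⁻¹ ≤ |wordProd M (i :: (l ++ [n])) 1 0| := by
    have h1 := (h.last_bound l n hl.tail).1
    have h2 : 2 * |wordProd M (l ++ [n]) 1 0| ≤ |wordProd M (i :: (l ++ [n])) 1 0| := by
      cases l with
      | nil => exact h.two_mul_abs_entry_le i n [] hl
      | cons j l => exact h.two_mul_abs_entry_le i j (l ++ [n]) hl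
    linarith
  rw [List.cons_append] at hy'
  set A := wordProd M (i :: (l ++ [n]))
  have hri := h.radius_pos i
  have hrn := h.radius_pos n
  have hA : A 1 0 ≠ 0 := abs_pos.mp (lt_of_lt_of_le (by positivity) hB)
  rw [trace_eq_mul_sub A hA, abs_mul]
  set u := A 0 0 / A 1 0
  set v := -(A 1 1) / A 1 0
  have hsep := h.separated (σ i) n hin
  rw [h.radius_inv] at hsep
  have hmax := le_max_right (r i) (r n)
  have huv : 3 / 2 * r n ≤ |u - v| := by
    have e : x (σ i) - x n = (u - v) - (u - x (σ i)) + (v - x n) := by ring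
    have t1 := abs_add_le ((u - v) - (u - x (σ i))) (v - x n)
    have t2 := abs_sub (u - v) (u - x (σ i))
    rw [← e] at t1
    linarith
  calc (3 : ℝ) = 2 * (r n)⁻¹ * (3 / 2 * r n) := by field_simp
    _ ≤ _ := by gcongr

theorem three_le_abs_trace_letter (h : IsSeparatedPairing M σ x r) (i : ι) :
    3 ≤ |M i 0 0 + M i 1 1| := by
  have hri := h.radius_pos i
  have hsep := h.separated (σ i) i (h.ne_self i)
  rw [h.radius_inv, max_self] at hsep
  have e : M i 0 0 + M i 1 1 = M i 1 0 * (x (σ i) - x i) := by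
    rw [h.top_left, h.bottom_row]; ring
  rw [e, abs_mul, ← h.inv_radius]
  calc (3 : ℝ) = (r i)⁻¹ * (r i + r i + r i) := by field_simp; norm_num
    _ ≤ _ := by gcongr

/-- Every word spells the identity or a matrix whose trace is at least `3` in absolute value:
cancelling letters and conjugating shortens a word until it is empty or cyclically reduced. -/
theorem eq_one_or_three_le (h : IsSeparatedPairing M σ x r) (l : List ι) :
    wordProd M l = 1 ∨ 3 ≤ |wordProd M l 0 0 + wordProd M l 1 1| := by
  induction hn : l.length using Nat.strong_induction_on generalizing l with
  | _ n ih =>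
  subst hn
  by_cases hl : IsReducedWord σ l
  · rcases l with _ | ⟨i, l⟩
    · exact Or.inl rfl
    rcases List.eq_nil_or_concat' l with rfl | ⟨l, n, rfl⟩
    · right
      simpa using h.three_le_abs_trace_letter i
    · by_cases hin : σ i = n
      · have e : wordProd M (i :: (l ++ [n])) = M i * wordProd M l * (M i)⁻¹ := by
          simp [← hin, h.map_inv, mul_assoc]
        rw [e, trace_conj]
        refine (ih l.length (by simp) l rfl).imp_left fun h1 => ?_
        rw [h1, mul_one, mul_inv_cancel]
      · exact Or.inr (h.three_le_abs_trace i n l hl hin)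
  · obtain ⟨l₁, i, l₂, rfl⟩ := exists_cancelling hl
    have e : wordProd M (l₁ ++ i :: σ i :: l₂) = wordProd M (l₁ ++ l₂) := by
      simp [h.map_inv]
    rw [e]
    exact ih _ (by simp) _ rfl

end IsSeparatedPairing

/-! ### Displacement and its consequences -/

/-- The displacement `δ` of a point satisfies `2 cosh δ ≥ tr² - 2`: for the point `z = x + iy`, the
difference of the two sides is the square of `(c |z|² + (d - a) x - b) / y`. -/
theorem le_cosh_dist_smul (A : SL(2, ℝ)) (z : ℍ) :
    1 + ((A 0 0 + A 1 1) ^ 2 - 4) / 2 ≤ Real.cosh (dist z (A • z)) := by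
  have hy := z.im_pos
  have hdet := det_eq_one A
  have hw : ((A • z : ℍ) : ℂ) = ((A 0 0 : ℂ) * z + A 0 1) / ((A 1 0 : ℂ) * z + A 1 1) := by
    rw [← psl_smul_mk, coe_psl_smul]
  set D : ℂ := (A 1 0 : ℂ) * z + A 1 1 with hD
  have hD2 : Complex.normSq D = (A 1 0 * z.re + A 1 1) ^ 2 + (A 1 0 * z.im) ^ 2 := by
    simp [hD, Complex.normSq_apply]; ring
  have hD0 : D ≠ 0 := by
    intro h0
    rw [h0, map_zero] at hD2
    have h1 : A 1 0 * z.im = 0 := by nlinarith [sq_nonneg (A 1 0 * z.re + A 1 1)]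
    have h2 : A 1 0 = 0 := by simpa [hy.ne'] using h1
    rw [h2] at hD2 hdet
    have h3 : A 1 1 = 0 := by nlinarith
    rw [h3] at hdet
    linarith
  have hDpos : 0 < Complex.normSq D := Complex.normSq_pos.mpr hD0
  have him : (A • z).im = z.im / Complex.normSq D := by
    rw [← UpperHalfPlane.coe_im, hw, Complex.div_im]
    field_simp
    simp [hD]
    linear_combination z.im * hdet
  have hdist : dist (z : ℂ) (A • z : ℍ) ^ 2 = Complex.normSq
      ((A 1 0 : ℂ) * z ^ 2 + (A 1 1 - A 0 0) * z - A 0 1) / Complex.normSq D := by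
    rw [dist_eq_norm, ← Complex.normSq_eq_norm_sq, ← map_div₀, hw]
    congr 1
    field_simp
    rw [hD]
    ring
  have hnum : Complex.normSq ((A 1 0 : ℂ) * z ^ 2 + (A 1 1 - A 0 0) * z - A 0 1) =
      ((A 0 0 + A 1 1) ^ 2 - 4) * z.im ^ 2 +
        (A 1 0 * z.re ^ 2 + (A 1 1 - A 0 0) * z.re - A 0 1 + A 1 0 * z.im ^ 2) ^ 2 := by
    simp [Complex.normSq_apply, sq]
    linear_combination -4 * z.im ^ 2 * hdet
  rw [UpperHalfPlane.cosh_dist, hdist, hnum, him]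
  refine add_le_add_right ?_ 1
  rw [div_le_div_iff₀ (by norm_num) (by positivity)]
  field_simp
  nlinarith [sq_nonneg
    (A 1 0 * z.re ^ 2 + (A 1 1 - A 0 0) * z.re - A 0 1 + A 1 0 * z.im ^ 2)]

/-- A lower bound on `cosh` gives one on the (nonnegative) argument. -/
theorem arcosh_le_of_le_cosh {a d : ℝ} (ha : 1 ≤ a) (hd : 0 ≤ d) (h : a ≤ Real.cosh d) :
    Real.arcosh a ≤ d := by
  rw [← Real.arcosh_cosh hd]
  exact (Real.arcosh_le_arcosh (by linarith) (by linarith)).mpr h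

section Displacement

variable {Γ : Subgroup PSL(2, ℝ)} {δ : ℝ}

theorem dist_smul_smul (g : PSL(2, ℝ)) (z w : ℍ) : dist (g • z) (g • w) = dist z w := by
  induction g using QuotientGroup.induction_on with
  | H A => rw [psl_smul_mk, psl_smul_mk, dist_smul]

theorem continuous_smul_point (z : ℍ) : Continuous fun g : PSL(2, ℝ) => g • z := by
  refine isQuotientMap_quotient_mk'.continuous_iff.mpr ?_
  change Continuous fun A : SL(2, ℝ) => A • z
  fun_prop

theorem eq_of_dist_lt (hΓ : ∀ γ ∈ Γ, γ ≠ 1 → ∀ z : ℍ, δ ≤ dist z (γ • z)) {γ γ' : Γ} {z : ℍ}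
    (h : dist (γ • z) (γ' • z) < δ) : γ = γ' := by
  by_contra hne
  refine absurd (hΓ (γ⁻¹ * γ' : Γ) (γ⁻¹ * γ').2 ?_ z) (not_le.mpr ?_)
  · intro e
    exact hne (inv_mul_eq_one.mp (Subtype.ext e))
  · have := dist_smul_smul (γ : PSL(2, ℝ)) z ((γ⁻¹ * γ' : Γ) • z)
    rw [← Subgroup.smul_def, ← Subgroup.smul_def, smul_smul, mul_inv_cancel_left] at this
    rw [← Subgroup.smul_def, ← this]
    exact h

theorem isFuchsian_of_displacement (hδ : 0 < δ)
    (hΓ : ∀ γ ∈ Γ, γ ≠ 1 → ∀ z : ℍ, δ ≤ dist z (γ • z)) : IsFuchsian Γ := by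
  refine discreteTopology_iff_isOpen_singleton.mpr fun γ => ?_
  have e : ({γ} : Set Γ) =
      {γ' : Γ | dist ((γ' : PSL(2, ℝ)) • UpperHalfPlane.I) (γ • UpperHalfPlane.I) < δ} := by
    ext γ'
    constructor
    · rintro rfl
      simpa [← Subgroup.smul_def] using hδ
    · exact eq_of_dist_lt hΓ
  rw [e]
  exact isOpen_lt (((continuous_smul_point _).comp continuous_subtype_val).dist continuous_const)
    continuous_const

theorem eq_one_of_smul_eq (hδ : 0 < δ)
    (hΓ : ∀ γ ∈ Γ, γ ≠ 1 → ∀ z : ℍ, δ ≤ dist z (γ • z)) (γ : Γ) (z : ℍ) (h : γ • z = z) :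
    γ = 1 :=
  eq_of_dist_lt hΓ (z := z) (by rwa [h, one_smul, dist_self])

/-- The elements carrying a compact set to one meeting another compact set move a base point by a
bounded amount. The orbit of the base point is uniformly separated, so that a ball contains only
finitely many of its points. -/
theorem properlyDiscontinuousSMul_of_displacement (hδ : 0 < δ)
    (hΓ : ∀ γ ∈ Γ, γ ≠ 1 → ∀ z : ℍ, δ ≤ dist z (γ • z)) : ProperlyDiscontinuousSMul Γ ℍ where
  finite_disjoint_inter_image {K L} hK hL := by
    obtain ⟨R, hR⟩ := hK.isBounded.subset_closedBall UpperHalfPlane.I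
    obtain ⟨R', hR'⟩ := hL.isBounded.subset_closedBall UpperHalfPlane.I
    have htb := (isCompact_closedBall UpperHalfPlane.I (R + R')).totallyBounded
    obtain ⟨t, ht, hcov⟩ := Metric.totallyBounded_iff.mp htb (δ / 2) (by positivity)
    refine (ht.biUnion (t := fun y => {γ : Γ | γ • UpperHalfPlane.I ∈ Metric.ball y (δ / 2)})
      fun y _ => Set.Subsingleton.finite fun γ hγ γ' hγ' => ?_).subset ?_
    · refine eq_of_dist_lt hΓ (z := UpperHalfPlane.I) ?_
      have h1 := dist_triangle_right (γ • UpperHalfPlane.I) (γ' • UpperHalfPlane.I) y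
      have h2 : dist (γ • UpperHalfPlane.I) y < δ / 2 := hγ
      have h3 : dist (γ' • UpperHalfPlane.I) y < δ / 2 := hγ'
      linarith
    · rintro γ ⟨_, ⟨z, hz, rfl⟩, hzL⟩
      have h1 : dist z UpperHalfPlane.I ≤ R := hR hz
      have h2 : dist (γ • z) UpperHalfPlane.I ≤ R' := hR' hzL
      have h3 : dist (γ • z) (γ • UpperHalfPlane.I) = dist z UpperHalfPlane.I :=
        dist_smul_smul (γ : PSL(2, ℝ)) z UpperHalfPlane.I
      have h4 : γ • UpperHalfPlane.I ∈ Metric.closedBall UpperHalfPlane.I (R + R') := by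
        have := dist_triangle_left (γ • UpperHalfPlane.I) UpperHalfPlane.I (γ • z)
        rw [Metric.mem_closedBall]
        linarith
      simpa using hcov h4

/-- The plane is simply connected and covers the orbit space, with deck group `Γ`. Monodromy
identifies the fundamental group with the opposite of `Γ`, hence with `Γ` by inversion. -/
theorem nonempty_fundamentalGroup_mulEquiv (hδ : 0 < δ)
    (hΓ : ∀ γ ∈ Γ, γ ≠ 1 → ∀ z : ℍ, δ ≤ dist z (γ • z)) (x : MulAction.orbitRel.Quotient Γ ℍ) :
    Nonempty (FundamentalGroup (MulAction.orbitRel.Quotient Γ ℍ) x ≃* Γ) := by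
  have : ContinuousConstSMul Γ ℍ :=
    ⟨fun γ => (Isometry.of_dist_eq (dist_smul_smul (γ : PSL(2, ℝ)))).continuous⟩
  have := properlyDiscontinuousSMul_of_displacement hδ hΓ
  have : IsCancelSMul Γ ℍ :=
    isCancelSMul_iff_eq_one_of_smul_eq.mpr (eq_one_of_smul_eq hδ hΓ)
  have hcov : IsQuotientCoveringMap (Quotient.mk (MulAction.orbitRel Γ ℍ)) Γ :=
    isQuotientCoveringMap_quotientMk_of_properlyDiscontinuousSMul
  obtain ⟨z, rfl⟩ := Quotient.mk_surjective x
  exact ⟨(hcov.fundamentalGroupEquiv ⟨z, rfl⟩).trans (MulEquiv.inv' Γ).symm⟩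

end Displacement

/-! ### Schottky descriptions from separated side pairings -/

/-- The lifts of a class in `PSL(2, ℝ)` differ by a sign. -/
theorem eq_or_eq_neg_of_mk_eq {A B : SL(2, ℝ)} (h : (A : PSL(2, ℝ)) = B) : A = B ∨ A = -B := by
  obtain ⟨s, hs, hsA⟩ := Matrix.SpecialLinearGroup.mem_center_iff.mp (QuotientGroup.eq.mp h)
  rw [Fintype.card_fin, sq_eq_one_iff] at hs
  rcases hs with rfl | rfl
  · left
    have : A⁻¹ * B = 1 := Subtype.ext (by rw [← hsA]; simp)
    exact inv_mul_eq_one.mp this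
  · right
    have : A⁻¹ * B = -1 := Subtype.ext (by
      rw [← hsA, Matrix.SpecialLinearGroup.coe_neg, Matrix.SpecialLinearGroup.coe_one, map_neg,
        map_one])
    rw [inv_mul_eq_iff_eq_mul] at this
    rw [this, mul_neg, mul_one, neg_neg]

theorem isometricCircle_eq_halfCircle {A : SL(2, ℝ)} {x r : ℝ}
    (hc : |A 1 0| * r = 1) (hd : A 1 1 = -(A 1 0 * x)) :
    isometricCircle A = halfCircle (x - r) (x + r) := by
  have hc0 : A 1 0 ≠ 0 := fun h0 => by simp [h0] at hc
  have key : ∀ z : ℍ, ‖(A 1 0 : ℂ) * z + A 1 1‖ = |A 1 0| * ‖(z : ℂ) - x‖ := fun z => by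
    rw [hd, ← Real.norm_eq_abs, ← Complex.norm_real, ← norm_mul]
    congr 1
    push_cast
    ring
  have key' : ∀ z : ℍ, (‖(A 1 0 : ℂ) * z + A 1 1‖ ^ 2)⁻¹ = 1 ↔ ‖(z : ℂ) - x‖ = r := fun z => by
    rw [key, inv_eq_one, pow_eq_one_iff_of_nonneg (by positivity) two_ne_zero]
    exact ⟨fun e => mul_left_cancel₀ (abs_ne_zero.mpr hc0) (e.trans hc.symm),
      fun e => by rw [e, hc]⟩
  ext z
  simp only [isometricCircle, halfCircle, Set.mem_ofPred_eq]
  rw [show (x - r + (x + r)) / 2 = x by ring, show (x + r - (x - r)) / 2 = r by ring, ← key' z]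
  constructor
  · rintro ⟨B, hB, -, hz⟩
    rcases eq_or_eq_neg_of_mk_eq hB with rfl | rfl
    · exact hz
    · simp only [Matrix.SpecialLinearGroup.coe_neg, Matrix.neg_apply, Complex.ofReal_neg,
        neg_mul] at hz
      rwa [← neg_add, norm_neg] at hz
  · exact fun hz => ⟨A, rfl, hc0, hz⟩

/-- Two boundary points are antipodal in the disc model only if their product is `-1`, so a closed
half-circle is not contained in the image of an interval avoiding `0`. -/
theorem not_closedHalfUnitCircle_subset {x r : ℝ} (hx : r < |x|) (u : ℂ) (hu : ‖u‖ = 1) :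
    ¬ closedHalfUnitCircle u ⊆
      (fun y : ℝ => cayley (y : ℂ)) '' closure (Set.Ioo (x - r) (x + r)) := by
  intro hsub
  have hmem : ∀ e : ℂ, ‖e‖ = 1 → e.re = 0 → e * u ∈ closedHalfUnitCircle u := fun e he he' => by
    refine ⟨by rw [norm_mul, he, hu, one_mul], ?_⟩
    rw [mul_assoc, Complex.mul_conj]
    simp [he']
  obtain ⟨p, hp, hpu⟩ := hsub (hmem Complex.I (by simp) (by simp))
  obtain ⟨q, hq, hqu⟩ := hsub (hmem (-Complex.I) (by simp) (by simp))
  have hne : ∀ y : ℝ, (y : ℂ) + Complex.I ≠ 0 := fun y h0 => by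
    simpa using congrArg Complex.im h0
  have hanti : cayley p + cayley q = 0 := by
    change cayley p = _ at hpu
    change cayley q = _ at hqu
    rw [hpu, hqu]
    ring
  have hpq : ((p * q + 1 : ℝ) : ℂ) = 0 := by
    have h1 := hne p
    have h2 := hne q
    rw [cayley, cayley, div_add_div _ _ h1 h2, div_eq_zero_iff] at hanti
    have h3 := hanti.resolve_right (mul_ne_zero h1 h2)
    push_cast
    linear_combination h3 / 2 + Complex.I_sq
  have hpq' : p * q + 1 = 0 := by exact_mod_cast hpq
  have hIcc := closure_minimal (Set.Ioo_subset_Icc_self (a := x - r) (b := x + r)) isClosed_Icc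
  obtain ⟨p1, p2⟩ := hIcc hp
  obtain ⟨q1, q2⟩ := hIcc hq
  rcases lt_abs.mp hx with h | h
  · nlinarith [mul_pos (show 0 < p by linarith) (show 0 < q by linarith)]
  · nlinarith [mul_pos_of_neg_of_neg (show p < 0 by linarith) (show q < 0 by linarith)]

/-- Two half-circles whose gap on the real line is at least the larger radius are at hyperbolic
distance at least `arcosh (3 / 2)`: the points on them have heights at most the radii, and their
Euclidean distance is at least the gap. -/
theorem arcosh_le_dist_of_mem_halfCircle {x r x' r' : ℝ} (hr : 0 < r) (hr' : 0 < r')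
    (hsep : r + r' + max r r' ≤ |x - x'|) {z w : ℍ} (hz : z ∈ halfCircle (x - r) (x + r))
    (hw : w ∈ halfCircle (x' - r') (x' + r')) : Real.arcosh (3 / 2) ≤ dist z w := by
  refine arcosh_le_of_le_cosh (by norm_num) dist_nonneg ?_
  simp only [halfCircle, Set.mem_ofPred_eq] at hz hw
  rw [show (x - r + (x + r)) / 2 = x by ring, show (x + r - (x - r)) / 2 = r by ring] at hz
  rw [show (x' - r' + (x' + r')) / 2 = x' by ring,
    show (x' + r' - (x' - r')) / 2 = r' by ring] at hw
  have hzi : z.im ≤ r := by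
    have := Complex.abs_im_le_norm ((z : ℂ) - x)
    rw [hz] at this
    simpa using (le_abs_self _).trans this
  have hwi : w.im ≤ r' := by
    have := Complex.abs_im_le_norm ((w : ℂ) - x')
    rw [hw] at this
    simpa using (le_abs_self _).trans this
  have hd : max r r' ≤ dist (z : ℂ) w := by
    have e : ((x - x' : ℝ) : ℂ) = (z - w) - (z - x) + (w - x') := by push_cast; ring
    have t1 := norm_add_le (((z : ℂ) - w) - (z - x)) (w - x')
    have t2 := norm_sub_le ((z : ℂ) - w) (z - x)
    rw [← e, Complex.norm_real, Real.norm_eq_abs] at t1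
    rw [dist_eq_norm]
    linarith
  have hzp := z.im_pos
  have hwp := w.im_pos
  have hd2 : z.im * w.im ≤ dist (z : ℂ) w ^ 2 := by
    calc z.im * w.im ≤ r * r' := by gcongr
      _ ≤ max r r' * max r r' := by
          gcongr
          · exact le_max_left _ _
          · exact le_max_right _ _
      _ ≤ _ := by rw [← sq]; gcongr
  rw [UpperHalfPlane.cosh_dist]
  have : (1 / 2 : ℝ) ≤ dist (z : ℂ) w ^ 2 / (2 * z.im * w.im) := by
    rw [le_div_iff₀ (by positivity)]
    linarith
  linarith

namespace IsSeparatedPairing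

variable {ι : Type*} {M : ι → SL(2, ℝ)} {σ : ι → ι} {x r : ι → ℝ}

/-- A separated side pairing none of whose intervals contains `0` gives a Schottky description, for
any numbering of some of the letters that turns inversion into negation. -/
theorem isSchottkyDescription (h : IsSeparatedPairing M σ x r) (hx : ∀ i, r i < |x i|)
    {I : Set ℤ} {d : ℤ → ι} (h0 : (0 : ℤ) ∉ I) (hneg : ∀ k ∈ I, -k ∈ I)
    (hd : ∀ k ∈ I, d (-k) = σ (d k)) (hinj : Set.InjOn d I) :
    IsSchottkyDescription I (fun k => x (d k) - r (d k)) (fun k => x (d k) + r (d k))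
      (fun k => (M (d k) : PSL(2, ℝ))) where
  zero_notMem := h0
  neg_mem := hneg
  lt k _ := by have := h.radius_pos (d k); linarith
  disjoint_closure k hk l hl hkl := by
    have hsep := h.separated (d k) (d l) fun e => hkl (hinj hk hl e)
    have hrk := h.radius_pos (d k)
    have hrl := h.radius_pos (d l)
    have hmax := le_max_left (r (d k)) (r (d l))
    refine Set.disjoint_left.mpr fun y hy hy' => ?_
    obtain ⟨a1, a2⟩ := closure_minimal Set.Ioo_subset_Icc_self isClosed_Icc hy
    obtain ⟨b1, b2⟩ := closure_minimal Set.Ioo_subset_Icc_self isClosed_Icc hy'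
    refine absurd hsep (not_le.mpr ?_)
    rw [abs_lt]
    constructor <;> linarith
  not_halfCircle_subset k _ u hu := not_closedHalfUnitCircle_subset (hx (d k)) u hu
  isometricCircle_eq k _ :=
    isometricCircle_eq_halfCircle (h.abs_mul_radius _) (h.bottom_row _)
  map_neg k hk := by
    rw [hd k hk, h.map_inv]
    rfl
  hyperbolic k _ := by
    refine ⟨M (d k), rfl, ?_⟩
    have := h.three_le_abs_trace_letter (d k)
    rw [Matrix.IsHyperbolic, Matrix.discr_fin_two, Matrix.trace_fin_two, (M (d k)).2, ← sq_abs]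
    nlinarith
  disjoint_nhds := by
    have hpos : 0 < Real.arcosh (3 / 2) := Real.arcosh_pos (by norm_num)
    refine ⟨Real.arcosh (3 / 2) / 4, by positivity, fun k hk l hl hkl => ?_⟩
    have hsep := h.separated (d k) (d l) fun e => hkl (hinj hk hl e)
    refine Set.disjoint_left.mpr fun y hy hy' => ?_
    have hlt : Real.arcosh (3 / 2) / 4 < Real.arcosh (3 / 2) / 2 := by linarith
    have hsub := fun E : Set ℍ => Metric.cthickening_subset_thickening' (half_pos hpos) hlt E
    obtain ⟨z, hz, hyz⟩ := Metric.mem_thickening_iff.mp (hsub _ hy)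
    obtain ⟨w, hw, hyw⟩ := Metric.mem_thickening_iff.mp (hsub _ hy')
    have h1 := arcosh_le_dist_of_mem_halfCircle (h.radius_pos _) (h.radius_pos _) hsep hz hw
    have h2 := dist_triangle_left z w y
    linarith

theorem exists_wordProd (h : IsSeparatedPairing M σ x r) (S : Set ι) {γ : PSL(2, ℝ)}
    (hγ : γ ∈ Subgroup.closure ((fun i => (M i : PSL(2, ℝ))) '' S)) :
    ∃ l : List ι, (wordProd M l : PSL(2, ℝ)) = γ := by
  induction hγ using Subgroup.closure_induction with
  | mem _ hx =>
    obtain ⟨i, -, rfl⟩ := hx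
    exact ⟨[i], by simp⟩
  | one => exact ⟨[], rfl⟩
  | mul _ _ _ _ ih ih' =>
    obtain ⟨l, rfl⟩ := ih
    obtain ⟨l', rfl⟩ := ih'
    exact ⟨l ++ l', by rw [wordProd_append]; rfl⟩
  | inv _ _ ih =>
    obtain ⟨l, rfl⟩ := ih
    exact ⟨(l.map σ).reverse, by rw [← h.wordProd_inv]; rfl⟩

/-- The nontrivial elements of a group generated by letters of a separated side pairing move all
points by at least `arcosh (7 / 2)`, where `7 = 3² - 2` comes from the bound `3` on the traces. -/
theorem displacement (h : IsSeparatedPairing M σ x r) (S : Set ι) {γ : PSL(2, ℝ)}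
    (hγ : γ ∈ Subgroup.closure ((fun i => (M i : PSL(2, ℝ))) '' S)) (hne : γ ≠ 1) (z : ℍ) :
    Real.arcosh (7 / 2) ≤ dist z (γ • z) := by
  obtain ⟨l, rfl⟩ := h.exists_wordProd S hγ
  rcases h.eq_one_or_three_le l with h1 | h3
  · exact absurd (by rw [h1]; rfl) hne
  · refine arcosh_le_of_le_cosh (by norm_num) dist_nonneg ?_
    rw [psl_smul_mk]
    refine le_trans ?_ (le_cosh_dist_smul _ z)
    rw [← sq_abs]
    nlinarith

end IsSeparatedPairing

/-! ### The generators as a separated side pairing -/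

/-- Indices of the generators: `inl t` stands for `f_{t+1}`, `inr (k, n, true)` for
`g_{k+1,n+1}` and `inr (k, n, false)` for `h_{k+1,n+1}`. -/
abbrev GenIndex : Type := ℕ ⊕ (ℕ × ℕ × Bool)

/-- The generator with a given index. -/
noncomputable def genMat : GenIndex → SL(2, ℝ)
  | .inl t => fMat (t + 1)
  | .inr (k, n, true) => gMat (k + 1) (n + 1)
  | .inr (k, n, false) => hMat (k + 1) (n + 1)

/-- The centre of the isometric circle of a generator. -/
noncomputable def genCenter : GenIndex → ℝ
  | .inl t => 5 * ((t + 1 : ℕ) : ℝ)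
  | .inr (k, n, b) =>
      5 * ((k + 1 : ℕ) : ℝ) - 3 + (if b then 13 else 17) * (cCoef (n + 1))⁻¹

/-- The radius of the isometric circle of a generator. -/
noncomputable def genRadius : GenIndex → ℝ
  | .inl _ => 1
  | .inr (_, n, _) => (cCoef (n + 1))⁻¹

/-- The exchange of `g_{k,n}` and `h_{k,n}`, which corresponds to the reflection of isometric circles
in the imaginary axis: the isometric circle of the inverse of a generator has the centre
opposite to that of the exchanged generator. -/
def genSwap : GenIndex → GenIndex
  | .inl t => .inl t
  | .inr (k, n, b) => .inr (k, n, !b)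

theorem genSwap_genSwap (j : GenIndex) : genSwap (genSwap j) = j := by
  rcases j with t | ⟨k, n, b⟩ <;> simp [genSwap]

theorem genRadius_genSwap (j : GenIndex) : genRadius (genSwap j) = genRadius j := by
  rcases j with t | ⟨k, n, b⟩ <;> rfl

theorem cCoef_pos (n : ℕ) : 0 < cCoef n := by unfold cCoef; positivity

theorem inv_cCoef_le (n : ℕ) : (cCoef (n + 1))⁻¹ ≤ 1 / 20 := by
  rw [inv_le_comm₀ (cCoef_pos _) (by norm_num), cCoef, pow_succ]
  have : (1 : ℝ) ≤ 2 ^ n := one_le_pow₀ (by norm_num)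
  linarith

/-- The radii belonging to successive values of `n` shrink by a factor of at least two. -/
theorem two_mul_inv_cCoef_le {n n' : ℕ} (h : n < n') :
    2 * (cCoef (n' + 1))⁻¹ ≤ (cCoef (n + 1))⁻¹ := by
  have h1 : 2 * cCoef (n + 1) ≤ cCoef (n' + 1) := by
    unfold cCoef
    have : (2 : ℝ) ^ (n + 1 + 1) ≤ 2 ^ (n' + 1) := pow_le_pow_right₀ (by norm_num) (by omega)
    rw [pow_succ] at this
    linarith
  have h2 := cCoef_pos (n + 1)
  have h3 := cCoef_pos (n' + 1)
  rw [← div_eq_mul_inv, div_le_iff₀ h3, inv_mul_eq_div, le_div_iff₀ h2]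
  exact h1

theorem genRadius_pos (j : GenIndex) : 0 < genRadius j := by
  rcases j with t | ⟨k, n, b⟩
  · exact one_pos
  · exact inv_pos.mpr (cCoef_pos _)

theorem genMat_abs_mul_radius (j : GenIndex) : |genMat j 1 0| * genRadius j = 1 := by
  have h := fun n => cCoef_ne_zero n
  rcases j with t | ⟨k, n, _ | _⟩
  · simp [genMat, fMat, genRadius]
  · simp [genMat, hMat, genRadius, abs_of_pos (cCoef_pos _), h]
  · simp [genMat, gMat, genRadius, abs_of_pos (cCoef_pos _), h]

theorem genMat_bottom_row (j : GenIndex) : genMat j 1 1 = -(genMat j 1 0 * genCenter j) := by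
  rcases j with t | ⟨k, n, _ | _⟩
  · simp [genMat, fMat, genCenter]
  · have h := cCoef_ne_zero (n + 1)
    simp [genMat, hMat, genCenter, qCoef]
    field_simp
    rw [cCoef]
    ring
  · have h := cCoef_ne_zero (n + 1)
    simp [genMat, gMat, genCenter, pCoef]
    field_simp
    rw [cCoef]
    ring

theorem genMat_top_left (j : GenIndex) :
    genMat j 0 0 = -(genMat j 1 0 * genCenter (genSwap j)) := by
  rcases j with t | ⟨k, n, _ | _⟩
  · simp [genMat, fMat, genCenter, genSwap]
  · have h := cCoef_ne_zero (n + 1)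
    simp [genMat, hMat, genCenter, pCoef, genSwap]
    field_simp
    rw [cCoef]
    ring
  · have h := cCoef_ne_zero (n + 1)
    simp [genMat, gMat, genCenter, qCoef, genSwap]
    field_simp
    rw [cCoef]
    ring

/-- The circles of the generators lie to the right of `0`, at a distance comparable with their
radii. -/
theorem two_mul_genRadius_le (j : GenIndex) : 2 * genRadius j ≤ genCenter j := by
  rcases j with t | ⟨k, n, b⟩
  · simp only [genRadius, genCenter]
    push_cast
    have : (0 : ℝ) ≤ t := t.cast_nonneg
    linarith
  · simp only [genRadius, genCenter]
    have h1 := inv_cCoef_le n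
    have h2 : 0 < (cCoef (n + 1))⁻¹ := inv_pos.mpr (cCoef_pos _)
    have h3 : (0 : ℝ) ≤ k := k.cast_nonneg
    push_cast
    split_ifs <;> linarith

theorem one_le_abs_cast_sub {a b : ℕ} (h : a ≠ b) : (1 : ℝ) ≤ |(a : ℝ) - b| := by
  have : (1 : ℤ) ≤ |(a : ℤ) - b| := Int.one_le_abs (sub_ne_zero.mpr (by exact_mod_cast h))
  exact_mod_cast this

/-- An `f`-circle and a `g`- or `h`-circle are separated. -/
theorem separated_inl_inr (t k n : ℕ) (b : Bool) :
    genRadius (.inl t) + genRadius (.inr (k, n, b)) +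
        max (genRadius (.inl t)) (genRadius (.inr (k, n, b))) ≤
      |genCenter (.inl t) - genCenter (.inr (k, n, b))| := by
  simp only [genRadius, genCenter]
  have h1 := inv_cCoef_le n
  have h2 : 0 < (cCoef (n + 1))⁻¹ := inv_pos.mpr (cCoef_pos _)
  set u := (cCoef (n + 1))⁻¹
  rw [max_eq_left (by linarith), le_abs]
  push_cast
  rcases lt_or_ge t k with h | h
  · right
    have : (t : ℝ) + 1 ≤ k := by exact_mod_cast h
    split_ifs <;> linarith
  · left
    have : (k : ℝ) ≤ t := by exact_mod_cast h
    split_ifs <;> linarith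

/-- Circles with the same `k` and different `n` are separated. -/
theorem separated_of_lt (k : ℕ) {n n' : ℕ} (h : n < n') (b b' : Bool) :
    genRadius (.inr (k, n, b)) + genRadius (.inr (k, n', b')) +
        max (genRadius (.inr (k, n, b))) (genRadius (.inr (k, n', b'))) ≤
      |genCenter (.inr (k, n, b)) - genCenter (.inr (k, n', b'))| := by
  simp only [genRadius, genCenter]
  have h1 := two_mul_inv_cCoef_le h
  have h2 : 0 < (cCoef (n' + 1))⁻¹ := inv_pos.mpr (cCoef_pos _)
  rw [max_eq_left (by linarith), le_abs]
  left
  split_ifs <;> linarith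

theorem genIndex_separated (j j' : GenIndex) (h : j ≠ j') :
    genRadius j + genRadius j' + max (genRadius j) (genRadius j') ≤
      |genCenter j - genCenter j'| := by
  rcases j with t | ⟨k, n, b⟩ <;> rcases j' with t' | ⟨k', n', b'⟩
  · have h1 := one_le_abs_cast_sub (a := t) (b := t') (by simpa using h)
    simp only [genRadius, genCenter, max_self]
    rw [← mul_sub, abs_mul]
    push_cast
    rw [add_sub_add_right_eq_sub, abs_of_pos (by norm_num : (0 : ℝ) < 5)]
    linarith
  · exact separated_inl_inr t k' n' b'
  · rw [add_comm (genRadius _) (genRadius (.inl t')), max_comm, abs_sub_comm]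
    exact separated_inl_inr t' k n b
  · by_cases hk : k = k'
    · subst hk
      rcases lt_trichotomy n n' with hn | rfl | hn
      · exact separated_of_lt k hn b b'
      · have hb : b' = !b := by cases b <;> cases b' <;> simp_all
        subst hb
        have h2 : 0 < (cCoef (n + 1))⁻¹ := inv_pos.mpr (cCoef_pos _)
        simp only [genRadius, genCenter, max_self]
        rw [le_abs]
        cases b
        · left
          simp only [Bool.not_false, if_true, Bool.false_eq_true, if_false]
          linarith
        · right
          simp only [Bool.not_true, if_true, Bool.false_eq_true, if_false]
          linarith
      · rw [add_comm (genRadius _) (genRadius (.inr (k, n', b'))), max_comm, abs_sub_comm]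
        exact separated_of_lt k hn b' b
    · simp only [genRadius, genCenter]
      have h1 := inv_cCoef_le n
      have h2 : 0 < (cCoef (n + 1))⁻¹ := inv_pos.mpr (cCoef_pos _)
      have h3 := inv_cCoef_le n'
      have h4 : 0 < (cCoef (n' + 1))⁻¹ := inv_pos.mpr (cCoef_pos _)
      have h5 := max_le h1 h3
      push_cast
      rw [le_abs]
      rcases Nat.lt_or_gt_of_ne hk with hk | hk
      · right
        have : (k : ℝ) + 1 ≤ k' := by exact_mod_cast hk
        split_ifs <;> linarith
      · left
        have : (k' : ℝ) + 1 ≤ k := by exact_mod_cast hk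
        split_ifs <;> linarith

/-- The generators (second component `true`) and their inverses (second component `false`). -/
noncomputable def letterMat (p : GenIndex × Bool) : SL(2, ℝ) :=
  if p.2 then genMat p.1 else (genMat p.1)⁻¹

/-- The centre of the isometric circle of a letter. -/
noncomputable def letterCenter (p : GenIndex × Bool) : ℝ :=
  if p.2 then genCenter p.1 else -genCenter (genSwap p.1)

/-- The formal inverse of a letter. -/
def letterInv (p : GenIndex × Bool) : GenIndex × Bool := (p.1, !p.2)

/-- The circles of the generators and those of their inverses lie on different sides of `0`. -/
theorem separated_of_opposite (j j' : GenIndex) :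
    genRadius j + genRadius j' + max (genRadius j) (genRadius j') ≤
      genCenter j + genCenter (genSwap j') := by
  have h1 := two_mul_genRadius_le j
  have h2 := two_mul_genRadius_le (genSwap j')
  rw [genRadius_genSwap] at h2
  have h3 := max_le_add_of_nonneg (genRadius_pos j).le (genRadius_pos j').le
  linarith

theorem isSeparatedPairing_letterMat :
    IsSeparatedPairing letterMat letterInv letterCenter (fun p => genRadius p.1) where
  involutive p := by simp [letterInv]
  ne_self p h := by simpa [letterInv] using congrArg Prod.snd h
  map_inv p := by rcases p with ⟨j, _ | _⟩ <;> simp [letterMat, letterInv]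
  radius_pos p := genRadius_pos p.1
  radius_inv p := rfl
  abs_mul_radius p := by
    rcases p with ⟨j, _ | _⟩
    · simpa [letterMat, inv_one_zero] using genMat_abs_mul_radius j
    · simpa [letterMat] using genMat_abs_mul_radius j
  bottom_row p := by
    rcases p with ⟨j, _ | _⟩
    · simpa [letterMat, letterCenter, inv_one_zero, inv_one_one] using genMat_top_left j
    · simpa [letterMat, letterCenter] using genMat_bottom_row j
  separated p p' h := by
    rcases p with ⟨j, _ | _⟩ <;> rcases p' with ⟨j', _ | _⟩
    · have hj : genSwap j ≠ genSwap j' := fun e => h (by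
        rw [← genSwap_genSwap j, e, genSwap_genSwap])
      have := genIndex_separated _ _ hj
      rw [genRadius_genSwap, genRadius_genSwap] at this
      simpa [letterCenter, neg_add_eq_sub, abs_sub_comm] using this
    · have := separated_of_opposite j' j
      rw [add_comm (genRadius _), max_comm]
      refine this.trans ?_
      rw [le_abs]
      right
      simp [letterCenter]
    · refine (separated_of_opposite j j').trans ?_
      rw [le_abs]
      left
      simp [letterCenter]
    · have hj : j ≠ j' := fun e => h (by rw [e])
      simpa [letterCenter] using genIndex_separated _ _ hj

theorem genRadius_lt_abs_letterCenter (p : GenIndex × Bool) : genRadius p.1 < |letterCenter p| := by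
  have h0 := genRadius_pos p.1
  rcases p with ⟨j, _ | _⟩
  · have := two_mul_genRadius_le (genSwap j)
    rw [genRadius_genSwap] at this
    simp only [letterCenter, Bool.false_eq_true, if_false, abs_neg]
    exact lt_of_lt_of_le (by linarith) (le_abs_self _)
  · have := two_mul_genRadius_le j
    simp only [letterCenter, if_true]
    exact lt_of_lt_of_le (by linarith) (le_abs_self _)

/-! ### The group `Γ_{m,s}` -/

/-- The indices of the generators of `Γ_{m,s}`. -/
def IsAdmissible (m s : ℕ) : GenIndex → Prop
  | .inl t => t + 2 ≤ s
  | .inr (k, _, _) => k + 1 ≤ m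

theorem generators_eq (m s : ℕ) :
    generators m s = {φ | ∃ j, IsAdmissible m s j ∧ (genMat j : PSL(2, ℝ)) = φ} := by
  ext φ
  constructor
  · rintro (⟨t, h1, h2, rfl⟩ | ⟨k, n, h1, h2, h3, rfl⟩ | ⟨k, n, h1, h2, h3, rfl⟩)
    · obtain ⟨t, rfl⟩ := Nat.exists_eq_add_of_le' h1
      exact ⟨.inl t, h2, rfl⟩
    · obtain ⟨k, rfl⟩ := Nat.exists_eq_add_of_le' h1
      obtain ⟨n, rfl⟩ := Nat.exists_eq_add_of_le' h3
      exact ⟨.inr (k, n, true), h2, rfl⟩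
    · obtain ⟨k, rfl⟩ := Nat.exists_eq_add_of_le' h1
      obtain ⟨n, rfl⟩ := Nat.exists_eq_add_of_le' h3
      exact ⟨.inr (k, n, false), h2, rfl⟩
  · rintro ⟨t | ⟨k, n, _ | _⟩, hj, rfl⟩
    · exact Or.inl ⟨t + 1, by omega, hj, rfl⟩
    · exact Or.inr (Or.inr ⟨k + 1, n + 1, by omega, hj, by omega, rfl⟩)
    · exact Or.inr (Or.inl ⟨k + 1, n + 1, by omega, hj, by omega, rfl⟩)

theorem Gam_eq_closure (m s : ℕ) :
    Gam m s = Subgroup.closure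
      ((fun p => (letterMat p : PSL(2, ℝ))) '' {p | IsAdmissible m s p.1}) := by
  rw [Gam, generators_eq]
  congr 1
  ext φ
  constructor
  · rintro (⟨j, hj, rfl⟩ | ⟨j, hj, e⟩)
    · exact ⟨(j, true), hj, rfl⟩
    · exact ⟨(j, false), hj, by rw [← inv_inv φ, ← e]; rfl⟩
  · rintro ⟨⟨j, _ | _⟩, hj, rfl⟩
    · exact Or.inr ⟨j, hj, by simp [letterMat]⟩
    · exact Or.inl ⟨j, hj, rfl⟩

/-- An arbitrary coding of the indices by natural numbers. -/
noncomputable def genCode : GenIndex ≃ ℕ := Classical.choice inferInstance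

/-- The numbering of the letters by nonzero integers: the sign of `k` tells a generator from its
inverse, and `|k| - 1` is the code of its index. The value at `0` plays no role. -/
noncomputable def letterOfInt (k : ℤ) : GenIndex × Bool :=
  (genCode.symm (k.natAbs - 1), decide (0 < k))

theorem letterOfInt_injOn : Set.InjOn letterOfInt {k | k ≠ 0} := by
  intro k hk l hl h
  have hk' : k ≠ 0 := hk
  have hl' : l ≠ 0 := hl
  have h1 := congrArg (fun p => genCode p.1) h
  have h2 := congrArg Prod.snd h
  simp only [letterOfInt, Equiv.apply_symm_apply, decide_eq_decide] at h1 h2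
  omega

theorem letterOfInt_neg {k : ℤ} (hk : k ≠ 0) : letterOfInt (-k) = letterInv (letterOfInt k) := by
  refine Prod.ext (by simp [letterOfInt, letterInv]) ?_
  simp only [letterOfInt, letterInv, ← decide_not, decide_eq_decide]
  omega

theorem exists_letterOfInt_eq (p : GenIndex × Bool) : ∃ k : ℤ, k ≠ 0 ∧ letterOfInt k = p := by
  rcases p with ⟨j, _ | _⟩
  · refine ⟨-(genCode j + 1 : ℕ), by omega, Prod.ext ?_ ?_⟩
    · simp only [letterOfInt, Int.natAbs_neg, Int.natAbs_natCast, Nat.add_sub_cancel,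
        Equiv.symm_apply_apply]
    · simp only [letterOfInt, decide_eq_false_iff_not]
      omega
  · refine ⟨(genCode j + 1 : ℕ), by omega, Prod.ext ?_ ?_⟩
    · simp only [letterOfInt, Int.natAbs_natCast, Nat.add_sub_cancel, Equiv.symm_apply_apply]
    · simp only [letterOfInt, decide_eq_true_eq]
      omega

theorem isGeometricSchottky_Gam (m s : ℕ) : IsGeometricSchottky (Gam m s) := by
  let I : Set ℤ := {k | k ≠ 0 ∧ IsAdmissible m s (letterOfInt k).1}
  refine ⟨I, _, _, _, isSeparatedPairing_letterMat.isSchottkyDescription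
    genRadius_lt_abs_letterCenter (I := I) (d := letterOfInt) (fun h => h.1 rfl)
    (fun k hk => ⟨neg_ne_zero.mpr hk.1, ?_⟩) (fun k hk => letterOfInt_neg hk.1)
    (letterOfInt_injOn.mono fun k hk => hk.1), ?_⟩
  · rw [letterOfInt_neg hk.1]
    exact hk.2
  · rw [Gam_eq_closure]
    congr 1
    ext φ
    constructor
    · rintro ⟨p, hp, rfl⟩
      obtain ⟨k, hk, rfl⟩ := exists_letterOfInt_eq p
      exact ⟨k, ⟨hk, hp⟩, rfl⟩
    · rintro ⟨k, hk, rfl⟩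
      exact ⟨letterOfInt k, hk.2, rfl⟩

theorem displacement_Gam (m s : ℕ) (γ : PSL(2, ℝ)) (hγ : γ ∈ Gam m s) (hne : γ ≠ 1) (z : ℍ) :
    Real.arcosh (7 / 2) ≤ dist z (γ • z) := by
  rw [Gam_eq_closure] at hγ
  exact isSeparatedPairing_letterMat.displacement _ hγ hne z

end SchottkySurface

theorem mainTheorem2 (m s : ℕ) (hm : 1 < m) (hms : m ≤ s) :
    SchottkySurface.IsGeometricSchottky (SchottkySurface.Gam m s) ∧
    SchottkySurface.IsFuchsian (SchottkySurface.Gam m s) ∧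
    (∀ (γ : SchottkySurface.Gam m s) (z : ℍ), γ • z = z → γ = 1) ∧
    ProperlyDiscontinuousSMul (SchottkySurface.Gam m s) ℍ ∧
    ∀ x : SchottkySurface.Surf m s,
      Nonempty (FundamentalGroup (SchottkySurface.Surf m s) x ≃* SchottkySurface.Gam m s) := by
  have hpos : 0 < Real.arcosh (7 / 2) := Real.arcosh_pos (by norm_num)
  have hdisp := SchottkySurface.displacement_Gam m s
  exact ⟨SchottkySurface.isGeometricSchottky_Gam m s,
    SchottkySurface.isFuchsian_of_displacement hpos hdisp,
    SchottkySurface.eq_one_of_smul_eq hpos hdisp,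
    SchottkySurface.properlyDiscontinuousSMul_of_displacement hpos hdisp,
    SchottkySurface.nonempty_fundamentalGroup_mulEquiv hpos hdisp⟩
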